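/- Let $n\ge 1$ be an integer and let $\Lambda\subseteq\mathbb{R}^n$ be a lattice of full rank. Let $\Phi$ be an endomorphism of $\mathbb{R}^n$ with $\Phi(\Lambda)\subseteq\Lambda$ all of whose (complex) eigenvalues have the same absolute value $\rho>1$, where $\rho^n\in\mathbb{N}$; in particular $\Phi$ is invertible. Let $T\subseteq\mathbb{R}^n$ be a closed set whose boundary has $n$-dimensional Lebesgue measure $0$ and which tiles $\mathbb{R}^n$ by $\Lambda$, i.e. $\bigcup_{z\in\Lambda}(z+T)=\mathbb{R}^n$ and $T\cap(z+T)\subseteq\partial T$ for all $z\in\Lambda\setminus\{0\}$. Let $\|\cdot\|$ be a norm on $\mathbb{R}^n$ whose induced operator norm satisfies $\|\Phi\|=\rho$ and $\|\Phi^{-1}\|=\rho^{-1}$, and let $r,R>0$ be reals with $$\{x\in\mathbb{R}^n:\|x\|\le r\}\subseteq T\subseteq\{x\in\mathbb{R}^n:\|x\|\le R\}.$$ Let $w$ be a positive integer with $R/r<\rho^w-1$. Let $\mathcal{D}\subseteq\Lambda$ be a reduced residue digit set modulo $\Phi^w$, i.e. $\mathcal{D}$ consists of $0$ and exactly one representative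 of each residue class of $\Lambda$ modulo $\Phi^w\Lambda$ that is not contained in $\Phi\Lambda$; suppose that $\mathcal{D}\subseteq\Phi^wT$ and that $\mathcal{D}$ has cardinality $\rho^{n(w-1)}(\rho^n-1)+1$. A sequence $\eta=(\eta_j)_{j\in\mathbb{Z}}\in\mathcal{D}^{\mathbb{Z}}$ is a width-$w$ non-adjacent form ($w$-NAF) if each block $\eta_{j+w-1}\ldots\eta_j$ of $w$ consecutive digits contains at most one non-zero digit. Define the fundamental domain $$\mathcal{F}=\Big\{\sum_{j\in\mathbb{Z}}\Phi^j\eta_j \;:\; \eta \text{ is a } w\text{-NAF with } \eta_j=0 \text{ for all } j\ge 0\Big\}.$$ Then the Hausdorff dimension of the boundary of the fundamental domain satisfies $$\dim_H \partial\mathcal{F}<n.$$ -/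

import Mathlib

/-- `T` tiles the space by translates under `Λ`: the translates cover, and
distinct translates overlap at most in the boundary. -/
def TilesBy {E : Type*} [AddCommGroup E] [TopologicalSpace E] (Λ : Submodule ℤ E) (T : Set E) :
    Prop :=
  (⋃ z ∈ Λ, (fun x => z + x) '' T) = Set.univ ∧
    ∀ z ∈ Λ, z ≠ 0 → T ∩ (fun x => z + x) '' T ⊆ frontier T

/-- `c` is the operator norm of `A` induced by the (semi)norm `N`. -/
def HasInducedNorm {E : Type*} [AddCommGroup E] [Module ℝ E] (N : Seminorm ℝ E) (A : E → E)
    (c : ℝ) : Prop :=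
  IsLUB ((fun x => N (A x)) '' {x | N x ≤ 1}) c

/-- `D` consists of `0` and exactly one representative of each residue class of `Λ` modulo
`Φ ^ w Λ` that is not contained in `Φ Λ`. Here `1 ≤ w` and `Φ Λ ⊆ Λ`, so the class of `x` is
contained in `Φ Λ` if and only if `x ∈ Φ Λ`. -/
structure IsReducedResidueDigitSet {E : Type*} [AddCommGroup E] [Module ℝ E]
    (Λ : Submodule ℤ E) (Φ : E ≃ₗ[ℝ] E) (w : ℕ) (D : Set E) : Prop where
  subset : D ⊆ Λ
  zero_mem : 0 ∈ D
  notMem_image : ∀ d ∈ D, d ≠ 0 → d ∉ Φ '' Λ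
  existsUnique : ∀ x ∈ Λ, x ∉ Φ '' Λ → ∃! d, d ∈ D ∧ x - d ∈ (Φ ^ w : E ≃ₗ[ℝ] E) '' Λ

/-- A two-sided sequence of digits is a width-`w` non-adjacent form if each block
`η_{j+w-1} … η_j` contains at most one non-zero digit. -/
def IsWNAF {E : Type*} [Zero E] (w : ℕ) (D : Set E) (η : ℤ → E) : Prop :=
  (∀ j, η j ∈ D) ∧
    ∀ j : ℤ, {i | i ∈ Set.Icc j (j + w - 1) ∧ η i ≠ 0}.Subsingleton

/-- The value `∑_{j ∈ ℤ} Φ^j η_j`. For an expanding `Φ`, a finite digit set and a sequence that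
vanishes at all large indices the series converges absolutely. -/
noncomputable def wnafValue {E : Type*} [AddCommGroup E] [Module ℝ E] [TopologicalSpace E]
    (Φ : E ≃ₗ[ℝ] E) (η : ℤ → E) : E :=
  ∑' j : ℤ, (Φ ^ j : E ≃ₗ[ℝ] E) (η j)

/-- The values of all width-`w` non-adjacent forms with integer part zero. -/
def fundamentalDomain {E : Type*} [AddCommGroup E] [Module ℝ E] [TopologicalSpace E]
    (Φ : E ≃ₗ[ℝ] E) (w : ℕ) (D : Set E) : Set E :=
  wnafValue Φ '' {η | IsWNAF w D η ∧ ∀ j : ℤ, 0 ≤ j → η j = 0}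

/-!
The induced norms force `Φ` to be a similarity of ratio `ρ` for the norm `N`, which becomes the norm
of the space.

Splitting off the first digit of a `w`-NAF writes `𝓕` as the union of the sets
`Φ⁻¹ d + Φ ^ (-ℓ d) 𝓕` for `d ∈ D`, where `ℓ 0 = 1` and `ℓ d = w` for `d ≠ 0`. By the cardinality of
`D` the ratios of these similarities satisfy `∑ ρ ^ (-n ℓ d) = 1`: the similarity dimension of the
system is `n`.

The bound `R / r < ρ ^ w - 1` makes the division `z = d + Φ ^ w y` shorten the vectors of `Λ`, so
each of them has a finite `w`-NAF and `Φ ^ (-k) Λ ⊆ Λ + 𝓕` for all `k`. The union of the sets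
`Φ ^ (-k) Λ` is dense and `Λ + 𝓕` is closed, hence `Λ + 𝓕` is the whole space, and by the Baire
category theorem `𝓕` has an interior point.

Consequently some piece of a high level of `𝓕` lies in the interior of `𝓕`. The frontier of `𝓕` is
then covered by its images under the other maps of that level, whose similarity dimension is smaller
than `n`.
-/

open Filter Metric Set Topology MeasureTheory
open scoped ENNReal NNReal Pointwise

section SelfSimilarSets

variable {X ι : Type*} {f : ι → X → X} {K : ι → ℝ≥0} {F : Set X} {k : ℕ}

/-- The composite `f p₀ ∘ ⋯ ∘ f pₖ₋₁` of maps of an iterated function system `f` along a word `p`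
of length `k`. -/
def wordMap (f : ι → X → X) : (k : ℕ) → (Fin k → ι) → X → X
  | 0, _ => id
  | k + 1, p => f (p 0) ∘ wordMap f k (Fin.tail p)

theorem mapsTo_wordMap (hf : ∀ i, MapsTo (f i) F F) (p : Fin k → ι) :
    MapsTo (wordMap f k p) F F := by
  induction k with
  | zero => exact mapsTo_id F
  | succ k ih => exact (hf (p 0)).comp (ih (Fin.tail p))

theorem subset_iUnion_wordMap_image (hF : F ⊆ ⋃ i, f i '' F) (k : ℕ) :
    F ⊆ ⋃ p, wordMap f k p '' F := by
  induction k with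
  | zero => exact fun x hx => mem_iUnion.2 ⟨Fin.elim0, x, hx, rfl⟩
  | succ k ih =>
    intro x hx
    obtain ⟨i, y, hy, rfl⟩ := mem_iUnion.1 (hF hx)
    obtain ⟨p, z, hz, rfl⟩ := mem_iUnion.1 (ih hy)
    exact mem_iUnion.2 ⟨Fin.cons i p, z, hz, rfl⟩

theorem isOpenMap_wordMap [TopologicalSpace X] (hf : ∀ i, IsOpenMap (f i)) (p : Fin k → ι) :
    IsOpenMap (wordMap f k p) := by
  induction k with
  | zero => exact IsOpenMap.id
  | succ k ih => exact (hf (p 0)).comp (ih (Fin.tail p))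

theorem frontier_subset_iUnion_image_of_image_subset_interior [TopologicalSpace X]
    (hFc : IsClosed F) (hF : F ⊆ ⋃ i, f i '' F) (hmaps : ∀ i, MapsTo (f i) F F)
    (hopen : ∀ i, IsOpenMap (f i)) {i₀ : ι} (hi₀ : f i₀ '' F ⊆ interior F) :
    frontier F ⊆ ⋃ i : {i // i ≠ i₀}, f i '' frontier F := by
  intro x hx
  obtain ⟨i, y, hy, rfl⟩ := mem_iUnion.1 (hF (hFc.frontier_subset hx))
  have hi : i ≠ i₀ := by
    rintro rfl
    exact hx.2 (hi₀ (mem_image_of_mem _ hy))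
  have hy' : y ∉ interior F := fun h =>
    hx.2 (interior_mono (hmaps i).image_subset
      ((hopen i).image_interior_subset F (mem_image_of_mem _ h)))
  exact mem_iUnion.2 ⟨⟨i, hi⟩, y, ⟨subset_closure hy, hy'⟩, rfl⟩

theorem lipschitzWith_wordMap [PseudoEMetricSpace X] (hf : ∀ i, LipschitzWith (K i) (f i))
    (p : Fin k → ι) : LipschitzWith (∏ j, K (p j)) (wordMap f k p) := by
  induction k with
  | zero =>
    rw [Fin.prod_univ_zero]
    exact LipschitzWith.id
  | succ k ih =>
    rw [Fin.prod_univ_succ]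
    exact (hf (p 0)).comp (ih (Fin.tail p))

theorem tendsto_pow_mul_nhds_zero {c : ℝ≥0} (hc : c < 1) {d : ℝ≥0∞} (hd : d ≠ ∞) :
    Tendsto (fun k : ℕ => (c : ℝ≥0∞) ^ k * d) atTop (𝓝 0) := by
  simpa using ENNReal.Tendsto.mul_const
    (ENNReal.tendsto_pow_atTop_nhds_zero_of_lt_one (by exact_mod_cast hc)) (Or.inr hd)

theorem exists_forall_ediam_wordMap_image_lt [PseudoEMetricSpace X] {c : ℝ≥0} (hc : c < 1)
    (hf : ∀ i, LipschitzWith c (f i)) (hF : ediam F ≠ ∞) {ε : ℝ≥0∞} (hε : 0 < ε) :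
    ∃ k ≠ 0, ∀ p : Fin k → ι, ediam (wordMap f k p '' F) < ε := by
  obtain ⟨k, hk, hk0⟩ := (((tendsto_pow_mul_nhds_zero hc hF).eventually_lt_const hε).and
    (eventually_ne_atTop 0)).exists
  refine ⟨k, hk0, fun p => ((lipschitzWith_wordMap hf p).ediam_image_le F).trans_lt ?_⟩
  simpa using hk

theorem exists_wordMap_image_subset_interior [PseudoEMetricSpace X] {c : ℝ≥0} (hc : c < 1)
    (hf : ∀ i, LipschitzWith c (f i)) (hF : ediam F ≠ ∞) (hcov : F ⊆ ⋃ i, f i '' F)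
    (hint : (interior F).Nonempty) :
    ∃ k ≠ 0, ∃ p : Fin k → ι, wordMap f k p '' F ⊆ interior F := by
  obtain ⟨x, hx⟩ := hint
  obtain ⟨ε, hε, hball⟩ := EMetric.isOpen_iff.1 isOpen_interior x hx
  obtain ⟨k, hk0, hk⟩ := exists_forall_ediam_wordMap_image_lt hc hf hF hε
  obtain ⟨p, hp⟩ := mem_iUnion.1 (subset_iUnion_wordMap_image hcov k (interior_subset hx))
  exact ⟨k, hk0, p, fun y hy => hball ((edist_le_ediam_of_mem hy hp).trans_lt (hk p))⟩

theorem exists_lt_one_forall_le [Finite ι] (hK : ∀ i, K i < 1) : ∃ c < 1, ∀ i, K i ≤ c := by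
  cases nonempty_fintype ι
  exact ⟨Finset.univ.sup K, (Finset.sup_lt_iff one_pos).2 fun i _ => hK i,
    fun i => Finset.le_sup (Finset.mem_univ i)⟩

variable [Fintype ι]

theorem exists_lt_sum_rpow_le_one {s : ℝ≥0} (hs : 0 < s) (hK : ∑ i, K i ^ (s : ℝ) < 1) :
    ∃ t : ℝ≥0, t < s ∧ ∑ i, K i ^ (t : ℝ) ≤ 1 := by
  have hcont : ContinuousAt (fun t : ℝ≥0 => ∑ i, K i ^ (t : ℝ)) s :=
    tendsto_finsetSum _ fun i _ =>
      (NNReal.continuousAt_rpow (Or.inr (by exact_mod_cast hs))).tendsto.comp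
        (tendsto_const_nhds.prodMk_nhds NNReal.continuous_coe.continuousAt)
  have hlt : ∀ᶠ t : ℝ≥0 in 𝓝[<] s, ∑ i, K i ^ (t : ℝ) < 1 :=
    (hcont.eventually_lt_const hK).filter_mono nhdsWithin_le_nhds
  have : (𝓝[<] s).NeBot := nhdsLT_neBot_of_exists_lt ⟨0, hs⟩
  obtain ⟨t, ht, hts⟩ := (hlt.and self_mem_nhdsWithin).exists
  exact ⟨t, hts, ht.le⟩

variable [EMetricSpace X]

theorem dimH_le_of_subset_iUnion_image (hf : ∀ i, LipschitzWith (K i) (f i)) (hK : ∀ i, K i < 1)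
    (hF : ediam F ≠ ∞) (hcov : F ⊆ ⋃ i, f i '' F) {s : ℝ≥0} (hs : ∑ i, K i ^ (s : ℝ) ≤ 1) :
    dimH F ≤ s := by
  borelize X
  obtain ⟨c, hc, hKc⟩ := exists_lt_one_forall_le hK
  have hlip : ∀ k (p : Fin k → ι), ediam (wordMap f k p '' F) ≤ (∏ j, K (p j) : ℝ≥0) * ediam F :=
    fun k p => (lipschitzWith_wordMap hf p).ediam_image_le F
  have hsum : ∀ k : ℕ,
      ∑ p : Fin k → ι, ediam (wordMap f k p '' F) ^ (s : ℝ) ≤ ediam F ^ (s : ℝ) := fun k =>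
    calc ∑ p : Fin k → ι, ediam (wordMap f k p '' F) ^ (s : ℝ)
        ≤ ∑ p : Fin k → ι, ((∏ j, K (p j) : ℝ≥0) * ediam F) ^ (s : ℝ) :=
          Finset.sum_le_sum fun p _ => ENNReal.rpow_le_rpow (hlip k p) s.coe_nonneg
      _ = ((∑ i, K i ^ (s : ℝ)) ^ k : ℝ≥0) * ediam F ^ (s : ℝ) := by
          simp_rw [ENNReal.mul_rpow_of_nonneg _ _ s.coe_nonneg, ← Finset.sum_mul,
            ← ENNReal.coe_rpow_of_nonneg _ s.coe_nonneg, ← NNReal.finsetProd_rpow,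
            Fintype.sum_pow]
          norm_cast
      _ ≤ ediam F ^ (s : ℝ) := mul_le_of_le_one_left' (by exact_mod_cast pow_le_one' hs k)
  refine dimH_le_of_hausdorffMeasure_ne_top
    (ne_top_of_le_ne_top (ENNReal.rpow_ne_top_of_nonneg s.coe_nonneg hF) ?_)
  refine (Measure.hausdorffMeasure_le_liminf_sum s F _ (tendsto_pow_mul_nhds_zero hc hF)
    (fun k p => wordMap f k p '' F)
    (.of_forall fun k p => (hlip k p).trans ?_)
    (.of_forall (subset_iUnion_wordMap_image hcov))).trans
    (liminf_le_of_frequently_le' (.of_forall hsum))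
  gcongr
  exact_mod_cast (Finset.prod_le_pow_card _ _ _ fun j _ => hKc (p j)).trans_eq (by simp)

theorem dimH_frontier_lt_of_eq_iUnion_image (hf : ∀ i, LipschitzWith (K i) (f i))
    (hopen : ∀ i, IsOpenMap (f i)) (hK0 : ∀ i, 0 < K i) (hK : ∀ i, K i < 1) (hFc : IsClosed F)
    (hF : ediam F ≠ ∞) (hint : (interior F).Nonempty) (hFeq : F = ⋃ i, f i '' F) {s : ℝ≥0}
    (hs0 : 0 < s) (hs : ∑ i, K i ^ (s : ℝ) ≤ 1) : dimH (frontier F) < s := by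
  classical
  obtain ⟨c, hc, hKc⟩ := exists_lt_one_forall_le hK
  obtain ⟨k, hk, p₀, hp₀⟩ := exists_wordMap_image_subset_interior hc
    (fun i => (hf i).weaken (hKc i)) hF hFeq.subset hint
  have hmaps : ∀ i, MapsTo (f i) F F := fun i x hx => by
    rw [hFeq]
    exact mem_iUnion.2 ⟨i, x, hx, rfl⟩
  have hcov : frontier F ⊆ ⋃ p : {p // p ≠ p₀}, wordMap f k p '' frontier F :=
    frontier_subset_iUnion_image_of_image_subset_interior hFc
      (subset_iUnion_wordMap_image hFeq.subset k) (mapsTo_wordMap hmaps)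
      (isOpenMap_wordMap hopen) hp₀
  have hwords : ∑ p : Fin k → ι, (∏ j, K (p j)) ^ (s : ℝ) ≤ 1 := by
    simpa only [Fintype.sum_pow, NNReal.finsetProd_rpow] using pow_le_one' hs k
  have hlt : ∑ p : {p // p ≠ p₀}, (∏ j, K (p.1 j)) ^ (s : ℝ) < 1 := by
    refine lt_of_lt_of_le ?_ hwords
    rw [← Fintype.sum_subtype_add_sum_subtype (· ≠ p₀)]
    refine lt_add_of_pos_right _ (Finset.sum_pos (fun p _ => ?_) ⟨⟨p₀, by simp⟩, by simp⟩)
    exact NNReal.rpow_pos (Finset.prod_pos fun j _ => hK0 _)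
  obtain ⟨t, hts, ht⟩ := exists_lt_sum_rpow_le_one hs0 hlt
  have hK' : ∀ p : Fin k → ι, ∏ j, K (p j) < 1 := fun p =>
    calc ∏ j, K (p j) ≤ c ^ k :=
          (Finset.prod_le_pow_card _ _ _ fun j _ => hKc (p j)).trans_eq (by simp)
      _ < 1 := pow_lt_one' hc hk
  have hdim : dimH (frontier F) ≤ t :=
    dimH_le_of_subset_iUnion_image (fun p : {p // p ≠ p₀} => lipschitzWith_wordMap hf p.1)
      (fun p => hK' p) (ne_top_of_le_ne_top hF (ediam_mono hFc.frontier_subset)) hcov ht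
  exact hdim.trans_lt (by exact_mod_cast hts)

end SelfSimilarSets

section WNAF

variable {E : Type*} [Zero E] {w : ℕ} {D : Set E} {η : ℤ → E} {d : E}

theorem isWNAF_iff :
    IsWNAF w D η ↔ (∀ j, η j ∈ D) ∧ ∀ i j : ℤ, i < j → j < i + w → η i = 0 ∨ η j = 0 := by
  refine and_congr_right fun _ => ⟨fun h i j hij hjw => ?_, fun h j x hx y hy => ?_⟩
  · by_contra! hne
    have := h i (x := i) ⟨⟨le_rfl, by omega⟩, hne.1⟩ (y := j) ⟨⟨hij.le, by omega⟩, hne.2⟩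
    omega
  · obtain ⟨⟨hx1, hx2⟩, hx⟩ := hx
    obtain ⟨⟨hy1, hy2⟩, hy⟩ := hy
    rcases lt_trichotomy x y with hxy | hxy | hxy
    · rcases h x y hxy (by omega) with h0 | h0 <;> contradiction
    · exact hxy
    · rcases h y x hxy (by omega) with h0 | h0 <;> contradiction

theorem isWNAF_zero (h0 : 0 ∈ D) : IsWNAF w D 0 :=
  isWNAF_iff.2 ⟨fun _ => h0, fun _ _ _ _ => Or.inl rfl⟩

theorem IsWNAF.shift (h : IsWNAF w D η) (m : ℤ) : IsWNAF w D fun j => η (j - m) := by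
  rw [isWNAF_iff] at h ⊢
  exact ⟨fun j => h.1 _, fun i j hij hjw => h.2 _ _ (by omega) (by omega)⟩

theorem IsWNAF.indicator (h : IsWNAF w D η) (h0 : 0 ∈ D) (s : Set ℤ) :
    IsWNAF w D (s.indicator η) := by
  classical
  rw [isWNAF_iff] at h ⊢
  refine ⟨fun j => ?_, fun i j hij hjw => ?_⟩
  · rw [indicator_apply]
    split_ifs
    exacts [h.1 j, h0]
  · exact (h.2 i j hij hjw).imp (indicator_apply_eq_zero.2 fun _ => ·)
      (indicator_apply_eq_zero.2 fun _ => ·)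

theorem IsWNAF.update (h : IsWNAF w D η) {p : ℤ} (hd : d ∈ D)
    (hp : d ≠ 0 → ∀ j, p - w < j → j < p + w → j ≠ p → η j = 0) :
    IsWNAF w D (Function.update η p d) := by
  rw [isWNAF_iff] at h ⊢
  refine ⟨fun j => ?_, fun i j hij hjw => ?_⟩
  · rcases eq_or_ne j p with rfl | hj
    · simpa using hd
    · simpa [hj] using h.1 j
  by_cases hd0 : d = 0
  · have hle : ∀ l, η l = 0 → Function.update η p d l = 0 := fun l hl => by
      rcases eq_or_ne l p with rfl | hlp <;> simp_all
    exact (h.2 i j hij hjw).imp (hle i) (hle j)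
  · rcases eq_or_ne i p with rfl | hi
    · exact Or.inr (by simpa [hij.ne'] using hp hd0 j (by omega) hjw hij.ne')
    rcases eq_or_ne j p with rfl | hj
    · exact Or.inl (by simpa [hi] using hp hd0 i (by omega) (by omega) hi)
    · simpa [hi, hj] using h.2 i j hij hjw

theorem isCompact_setOf_isWNAF [TopologicalSpace E] [T1Space E] (hD : IsCompact D) :
    IsCompact {η | IsWNAF w D η ∧ ∀ j : ℤ, 0 ≤ j → η j = 0} := by
  have hclosed : IsClosed {η : ℤ → E | (∀ i j : ℤ, i < j → j < i + w → η i = 0 ∨ η j = 0) ∧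
      ∀ j : ℤ, 0 ≤ j → η j = 0} := by
    have hzero : ∀ j : ℤ, IsClosed {η : ℤ → E | η j = 0} := fun j =>
      isClosed_singleton.preimage (continuous_apply j)
    simp only [ofPred_and, ofPred_forall, ofPred_or]
    exact (isClosed_iInter fun i => isClosed_iInter fun j => isClosed_iInter fun _ =>
      isClosed_iInter fun _ => (hzero i).union (hzero j)).inter
        (isClosed_iInter fun j => isClosed_iInter fun _ => hzero j)
  convert (isCompact_univ_pi fun _ : ℤ => hD).inter_right hclosed using 1
  ext η
  simp only [isWNAF_iff, mem_ofPred_eq, mem_inter_iff, mem_univ_pi, and_assoc]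

open Classical in
/-- The number of positions which a digit `d` takes up in a width-`w` non-adjacent form, including
the `w - 1` zeros that are forced next to it if it is not zero itself. -/
noncomputable def digitLength (w : ℕ) (d : E) : ℕ :=
  if d = 0 then 1 else w

theorem digitLength_zero : digitLength w (0 : E) = 1 :=
  if_pos rfl

theorem digitLength_of_ne_zero (hd : d ≠ 0) : digitLength w d = w :=
  if_neg hd

theorem digitLength_pos (hw : 1 ≤ w) (d : E) : 0 < digitLength w d := by
  unfold digitLength
  split_ifs <;> omega

theorem digitLength_le (hw : 1 ≤ w) (d : E) : digitLength w d ≤ w := by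
  unfold digitLength
  split_ifs <;> omega

theorem IsWNAF.update_shift_neg_one (h : IsWNAF w D η) (h0 : ∀ j, 0 ≤ j → η j = 0)
    (hd : d ∈ D) : IsWNAF w D (Function.update (fun j => η (j - -digitLength w d)) (-1) d) := by
  refine (h.shift _).update hd fun hd0 j hj _ _ => h0 _ ?_
  rw [digitLength_of_ne_zero hd0]
  omega

theorem IsWNAF.update_shift_zero (h : IsWNAF w D η) (h0 : ∀ j < 0, η j = 0) {m : ℕ}
    (hm : digitLength w d ≤ m) (hd : d ∈ D) :
    IsWNAF w D (Function.update (fun j => η (j - m)) 0 d) := by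
  refine (h.shift _).update hd fun hd0 j _ hj _ => h0 _ ?_
  rw [digitLength_of_ne_zero hd0] at hm
  omega

theorem IsWNAF.apply_eq_zero_of_neg_digitLength_le (h : IsWNAF w D η) (h0 : ∀ j, 0 ≤ j → η j = 0)
    {j : ℤ} (hj : -digitLength w (η (-1)) ≤ j) (hj1 : j ≠ -1) : η j = 0 := by
  rcases le_or_gt 0 j with hj0 | hj0
  · exact h0 j hj0
  by_cases hd : η (-1) = 0
  · rw [hd, digitLength_zero] at hj
    omega
  · rw [digitLength_of_ne_zero hd] at hj
    exact ((isWNAF_iff.1 h).2 j (-1) (by omega) (by omega)).resolve_right hd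

end WNAF

section Shift

variable {E : Type*} [AddCommGroup E] [Module ℝ E] {Φ : E ≃ₗ[ℝ] E}

theorem zpow_apply_zpow_apply (Φ : E ≃ₗ[ℝ] E) (m p : ℤ) (x : E) :
    (Φ ^ m) ((Φ ^ p) x) = (Φ ^ (m + p)) x := by
  rw [zpow_add, LinearEquiv.mul_apply]

variable [TopologicalSpace E] {η : ℤ → E} {d x : E} {m p : ℤ}

theorem hasSum_zpow_apply_shift (hΦ : Continuous (Φ ^ m))
    (h : HasSum (fun j : ℤ => (Φ ^ j) (η j)) x) :
    HasSum (fun j : ℤ => (Φ ^ j) (η (j - m))) ((Φ ^ m) x) := by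
  rw [← (Equiv.addRight m).hasSum_iff]
  convert h.map (Φ ^ m) hΦ using 1
  funext j
  simp [zpow_apply_zpow_apply, add_comm m]

variable [T2Space E]

theorem wnafValue_shift (hΦ : Continuous (Φ ^ m)) (hη : Summable fun j : ℤ => (Φ ^ j) (η j)) :
    wnafValue Φ (fun j => η (j - m)) = (Φ ^ m) (wnafValue Φ η) :=
  (hasSum_zpow_apply_shift hΦ hη.hasSum).tsum_eq

theorem wnafValue_update_shift [ContinuousAdd E] (hΦ : Continuous (Φ ^ m))
    (hη : Summable fun j : ℤ => (Φ ^ j) (η j)) (hp : η (p - m) = 0) :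
    wnafValue Φ (Function.update (fun j => η (j - m)) p d) =
      (Φ ^ p) d + (Φ ^ m) (wnafValue Φ η) := by
  have hsum := (hasSum_pi_single p ((Φ ^ p) d)).add (hasSum_zpow_apply_shift hΦ hη.hasSum)
  refine (hsum.congr_fun fun j => ?_).tsum_eq
  rcases eq_or_ne j p with rfl | hj
  · simp [hp]
  · simp [hj]

end Shift

section Value

variable {E : Type*} [NormedAddCommGroup E] [NormedSpace ℝ E] {w : ℕ} {D : Set E} {η : ℤ → E}
  {x : E} {Φ : E ≃ₗ[ℝ] E} {ρ M : ℝ} {K m : ℤ}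

theorem norm_zpow_apply (hρ : 0 < ρ) (hΦ : ∀ x, ‖Φ x‖ = ρ * ‖x‖) (m : ℤ) (x : E) :
    ‖(Φ ^ m) x‖ = ρ ^ m * ‖x‖ := by
  induction m with
  | zero => simp
  | succ m ih =>
    rw [zpow_add_one₀ hρ.ne', add_comm, zpow_add, zpow_one, LinearEquiv.mul_apply, hΦ, ih]
    ring
  | pred m ih =>
    have h := hΦ ((Φ ^ (-(m : ℤ) - 1)) x)
    rw [← LinearEquiv.mul_apply, ← zpow_one_add, add_sub_cancel, ih] at h
    rw [zpow_sub_one₀ hρ.ne']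
    field_simp
    linarith

theorem continuous_zpow_apply (hρ : 0 < ρ) (hΦ : ∀ x, ‖Φ x‖ = ρ * ‖x‖) (m : ℤ) :
    Continuous (Φ ^ m) :=
  AddMonoidHomClass.continuous_of_bound _ (ρ ^ m) fun x => (norm_zpow_apply hρ hΦ m x).le

theorem isOpenMap_zpow_apply (hρ : 0 < ρ) (hΦ : ∀ x, ‖Φ x‖ = ρ * ‖x‖) (m : ℤ) :
    IsOpenMap (Φ ^ m) :=
  IsOpenMap.of_inverse (continuous_zpow_apply hρ hΦ (-m)) (fun x => by simp) fun x => by simp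

theorem summable_indicator_Iio_zpow (hρ : 1 < ρ) (M : ℝ) (K : ℤ) :
    Summable ((Iio K).indicator fun j => M * ρ ^ j) := by
  have hinj : Function.Injective fun n : ℕ => K - 1 - n := fun a b h => by simpa using h
  have hrange : ∀ j ∉ range fun n : ℕ => K - 1 - n,
      (Iio K).indicator (fun j => M * ρ ^ j) j = 0 := fun j hj =>
    indicator_of_notMem (fun hjK => hj ⟨(K - 1 - j).toNat, by grind⟩) _
  rw [← hinj.summable_iff hrange]
  refine ((summable_geometric_of_lt_one (by positivity) (inv_lt_one_of_one_lt₀ hρ)).mul_left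
    (M * ρ ^ (K - 1))).congr fun n => ?_
  have hn : K - 1 - n < K := by omega
  simp [hn, zpow_sub₀ (one_pos.trans hρ).ne' (K - 1), div_eq_mul_inv, mul_assoc]

theorem norm_zpow_apply_le_indicator (hρ : 0 < ρ) (hΦ : ∀ x, ‖Φ x‖ = ρ * ‖x‖) (hM : ‖x‖ ≤ M)
    (hK : K ≤ m → x = 0) : ‖(Φ ^ m) x‖ ≤ (Iio K).indicator (fun j => M * ρ ^ j) m := by
  by_cases hm : m < K
  · rw [indicator_of_mem (mem_Iio.2 hm), norm_zpow_apply hρ hΦ, mul_comm]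
    gcongr
  · rw [indicator_of_notMem (notMem_Iio.2 (not_lt.1 hm)), hK (not_lt.1 hm), map_zero, norm_zero]

variable [CompleteSpace E]

theorem summable_zpow_apply (hρ : 1 < ρ) (hΦ : ∀ x, ‖Φ x‖ = ρ * ‖x‖) (hD : Bornology.IsBounded D)
    (hη : ∀ j, η j ∈ D) (hK : ∀ j, K ≤ j → η j = 0) : Summable fun j : ℤ => (Φ ^ j) (η j) := by
  obtain ⟨M, hM⟩ := hD.exists_norm_le
  exact (summable_indicator_Iio_zpow hρ M K).of_norm_bounded fun j =>
    norm_zpow_apply_le_indicator (one_pos.trans hρ) hΦ (hM _ (hη j)) (hK j)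

theorem isCompact_fundamentalDomain (hρ : 1 < ρ) (hΦ : ∀ x, ‖Φ x‖ = ρ * ‖x‖) (hD : IsCompact D) :
    IsCompact (fundamentalDomain Φ w D) := by
  obtain ⟨M, hM⟩ := hD.isBounded.exists_norm_le
  have hρ0 : 0 < ρ := one_pos.trans hρ
  refine (isCompact_setOf_isWNAF hD).image_of_continuousOn
    (continuousOn_tsum (fun j => ?_) (summable_indicator_Iio_zpow hρ M 0) fun j η hη =>
      norm_zpow_apply_le_indicator hρ0 hΦ (hM _ (hη.1.1 j)) (hη.2 j))
  exact ((continuous_zpow_apply hρ0 hΦ j).comp (continuous_apply j)).continuousOn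

theorem fundamentalDomain_eq_iUnion (hρ : 1 < ρ) (hΦ : ∀ x, ‖Φ x‖ = ρ * ‖x‖)
    (hD : Bornology.IsBounded D) (h0 : 0 ∈ D) (hw : 1 ≤ w) :
    fundamentalDomain Φ w D = ⋃ d : D, (fun x => (Φ ^ (-1 : ℤ)) d.1 +
      (Φ ^ (-digitLength w d.1 : ℤ)) x) '' fundamentalDomain Φ w D := by
  have hvalue : ∀ d, ∀ η, IsWNAF w D η → (∀ j, 0 ≤ j → η j = 0) →
      wnafValue Φ (Function.update (fun j => η (j - -digitLength w d)) (-1) d) =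
        (Φ ^ (-1 : ℤ)) d + (Φ ^ (-digitLength w d : ℤ)) (wnafValue Φ η) := fun d η hη hη0 =>
    wnafValue_update_shift (continuous_zpow_apply (one_pos.trans hρ) hΦ _)
      (summable_zpow_apply hρ hΦ hD hη.1 hη0) (hη0 _ (by have := digitLength_pos hw d; omega))
  refine Subset.antisymm ?_ (iUnion_subset fun d => ?_)
  · rintro _ ⟨η, ⟨hη, hη0⟩, rfl⟩
    set ℓ : ℤ := (digitLength w (η (-1)) : ℤ) with hℓ
    set θ : ℤ → E := fun j => Function.update η (-1) 0 (j - ℓ) with hθ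
    have hθw : IsWNAF w D θ := (hη.update h0 (by simp)).shift ℓ
    have hθ0 : ∀ j, 0 ≤ j → θ j = 0 := fun j hj => by
      rcases eq_or_ne (j - ℓ) (-1) with h | h
      · simp [hθ, h]
      · simpa [hθ, h] using hη.apply_eq_zero_of_neg_digitLength_le hη0 (by omega) h
    refine mem_iUnion.2 ⟨⟨η (-1), hη.1 _⟩, wnafValue Φ θ, ⟨θ, ⟨hθw, hθ0⟩, rfl⟩, ?_⟩
    simpa [hθ, hℓ] using (hvalue (η (-1)) θ hθw hθ0).symm
  · rintro _ ⟨_, ⟨η, ⟨hη, hη0⟩, rfl⟩, rfl⟩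
    refine ⟨_, ⟨hη.update_shift_neg_one hη0 d.2, fun j hj => ?_⟩, hvalue d η hη hη0⟩
    rw [Function.update_of_ne (by omega)]
    exact hη0 _ (by omega)

end Value

theorem isClosed_coe_of_discreteTopology {E : Type*} [AddCommGroup E] [TopologicalSpace E]
    [IsTopologicalAddGroup E] [T2Space E] (Λ : Submodule ℤ E) [DiscreteTopology Λ] :
    IsClosed (Λ : Set E) :=
  have : DiscreteTopology Λ.toAddSubgroup := ‹DiscreteTopology Λ›
  AddSubgroup.isClosed_of_discrete (H := Λ.toAddSubgroup)

theorem coe_subset_of_forall_norm_lt_imp_mem {E : Type*} [NormedAddCommGroup E] [ProperSpace E]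
    {Λ : Submodule ℤ E} [DiscreteTopology Λ] {S : Set E}
    (h : ∀ z ∈ Λ, (∀ y ∈ Λ, ‖y‖ < ‖z‖ → y ∈ S) → z ∈ S) : (Λ : Set E) ⊆ S := by
  intro z hz
  by_contra hzS
  have hfin : {y | y ∈ closedBall 0 ‖z‖ ∧ y ∈ Λ}.Finite :=
    finite_isBounded_inter_isClosed (DiscreteTopology.isDiscrete (s := (Λ : Set E)))
      isBounded_closedBall (isClosed_coe_of_discreteTopology Λ)
  obtain ⟨y, ⟨⟨hyz, hy⟩, hyS⟩, hmin⟩ := (hfin.inter_of_left Sᶜ).exists_minimalFor norm _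
    ⟨z, ⟨by simp, hz⟩, hzS⟩
  refine hyS (h y hy fun x hx hxy => ?_)
  by_contra hxS
  have hxz : x ∈ closedBall 0 ‖z‖ := by
    rw [mem_closedBall_zero_iff] at hyz ⊢
    exact hxy.le.trans hyz
  exact hxy.not_ge (hmin ⟨⟨hxz, hx⟩, hxS⟩ hxy.le)

theorem interior_nonempty_of_add_eq_univ {G : Type*} [TopologicalSpace G] [AddGroup G]
    [ContinuousAdd G] [BaireSpace G] {s F : Set G} (hs : s.Countable) (hF : IsClosed F)
    (h : s + F = univ) : (interior F).Nonempty := by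
  have : Countable s := hs.to_subtype
  obtain ⟨y, hy⟩ := nonempty_interior_of_iUnion_of_closed
    (f := fun y : s => Homeomorph.addLeft y.1 '' F)
    (fun y => (Homeomorph.addLeft y.1).isClosedMap _ hF)
    (by rw [← h, ← iUnion_add_left_image, biUnion_eq_iUnion]; rfl)
  rw [← Homeomorph.image_interior] at hy
  exact hy.of_image

section Integers

variable {E : Type*} [AddCommGroup E] [Module ℝ E] {w : ℕ} {D : Set E} {η : ℤ → E}
  {Φ : E ≃ₗ[ℝ] E} {Λ : Submodule ℤ E}

theorem pow_apply_mem (hΦΛ : ∀ x ∈ Λ, Φ x ∈ Λ) {x : E} (hx : x ∈ Λ) (k : ℕ) : (Φ ^ k) x ∈ Λ := by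
  induction k with
  | zero => simpa using hx
  | succ k ih =>
    rw [pow_succ', LinearEquiv.mul_apply]
    exact hΦΛ _ ih

variable [TopologicalSpace E]

theorem wnafValue_indicator_Ici_mem (hΦΛ : ∀ x ∈ Λ, Φ x ∈ Λ) (hη : ∀ j, η j ∈ Λ)
    {K : ℤ} (hK : ∀ j, K ≤ j → η j = 0) : wnafValue Φ ((Ici 0).indicator η) ∈ Λ := by
  rw [wnafValue, tsum_eq_sum (s := Finset.Ico 0 K)]
  · refine Submodule.sum_mem _ fun j hj => ?_
    have hj0 : 0 ≤ j := (Finset.mem_Ico.1 hj).1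
    obtain ⟨k, rfl⟩ := Int.eq_ofNat_of_zero_le hj0
    rw [indicator_of_mem (mem_Ici.2 hj0), zpow_natCast]
    exact pow_apply_mem hΦΛ (hη k) k
  · intro j hj
    rw [Finset.mem_Ico, not_and_or, not_le, not_lt] at hj
    rcases hj with hj | hj
    · rw [indicator_of_notMem (notMem_Ici.2 hj), map_zero]
    · rw [indicator_apply_eq_zero.2 fun _ => hK j hj, map_zero]

/-- The values of the width-`w` non-adjacent forms with finitely many non-zero digits, all of them
at non-negative positions; these are the integers of the numeral system. -/
def wnafIntegers (Φ : E ≃ₗ[ℝ] E) (w : ℕ) (D : Set E) : Set E :=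
  wnafValue Φ '' {η | IsWNAF w D η ∧ (∀ j < 0, η j = 0) ∧ ∃ K : ℤ, ∀ j, K ≤ j → η j = 0}

theorem zero_mem_wnafIntegers (h0 : 0 ∈ D) : 0 ∈ wnafIntegers Φ w D :=
  ⟨0, ⟨isWNAF_zero h0, fun _ _ => rfl, 0, fun _ _ => rfl⟩, by simp [wnafValue]⟩

end Integers

section Lattice

variable {E : Type*} [NormedAddCommGroup E] [NormedSpace ℝ E] {w : ℕ} {D T : Set E}
  {Φ : E ≃ₗ[ℝ] E} {ρ r R : ℝ} {Λ : Submodule ℤ E}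

theorem add_pow_apply_mem_wnafIntegers [CompleteSpace E] (hρ : 1 < ρ)
    (hΦ : ∀ x, ‖Φ x‖ = ρ * ‖x‖) (hD : Bornology.IsBounded D) {d y : E} (hd : d ∈ D) {m : ℕ}
    (hm0 : 0 < m) (hm : digitLength w d ≤ m) (hy : y ∈ wnafIntegers Φ w D) :
    d + (Φ ^ m) y ∈ wnafIntegers Φ w D := by
  obtain ⟨η, ⟨hη, hη0, K, hK⟩, rfl⟩ := hy
  refine ⟨_, ⟨hη.update_shift_zero hη0 hm hd, fun j hj => ?_, max (K + m) 1, fun j hj => ?_⟩, ?_⟩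
  · rw [Function.update_of_ne (by omega)]
    exact hη0 _ (by omega)
  · rw [Function.update_of_ne (by omega)]
    exact hK _ (by omega)
  · simpa using wnafValue_update_shift (m := m) (p := 0) (d := d)
      (continuous_zpow_apply (one_pos.trans hρ) hΦ m) (summable_zpow_apply hρ hΦ hD hη.1 hK)
      (hη0 _ (by omega))

theorem wnafValue_mem_add_fundamentalDomain [CompleteSpace E] (hρ : 1 < ρ)
    (hΦ : ∀ x, ‖Φ x‖ = ρ * ‖x‖) (hΦΛ : ∀ x ∈ Λ, Φ x ∈ Λ) (hD : Bornology.IsBounded D)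
    (hDΛ : D ⊆ Λ) (h0 : 0 ∈ D) {η : ℤ → E} (hη : IsWNAF w D η) {K : ℤ}
    (hK : ∀ j, K ≤ j → η j = 0) :
    wnafValue Φ η ∈ (Λ : Set E) + fundamentalDomain Φ w D := by
  have hsum : ∀ s : Set ℤ, Summable fun j : ℤ => (Φ ^ j) (s.indicator η j) := fun s =>
    summable_zpow_apply hρ hΦ hD (hη.indicator h0 s).1
      fun j hj => indicator_apply_eq_zero.2 fun _ => hK j hj
  refine mem_add.2 ⟨_, wnafValue_indicator_Ici_mem hΦΛ (fun j => hDΛ (hη.1 j)) hK,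
    wnafValue Φ ((Ici 0)ᶜ.indicator η), ⟨_, ⟨hη.indicator h0 _, fun j hj =>
      indicator_of_notMem (notMem_compl_iff.2 (mem_Ici.2 hj)) η⟩, rfl⟩, ?_⟩
  rw [wnafValue, wnafValue, ← (hsum _).tsum_add (hsum _), wnafValue]
  simp only [← map_add, indicator_self_add_compl_apply]

theorem zpow_apply_mem_add_fundamentalDomain [CompleteSpace E] (hρ : 1 < ρ)
    (hΦ : ∀ x, ‖Φ x‖ = ρ * ‖x‖) (hΦΛ : ∀ x ∈ Λ, Φ x ∈ Λ) (hD : Bornology.IsBounded D)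
    (hDΛ : D ⊆ Λ) (h0 : 0 ∈ D) {z : E} (hz : z ∈ wnafIntegers Φ w D) (m : ℤ) :
    (Φ ^ m) z ∈ (Λ : Set E) + fundamentalDomain Φ w D := by
  obtain ⟨η, ⟨hη, -, K, hK⟩, rfl⟩ := hz
  rw [← wnafValue_shift (continuous_zpow_apply (one_pos.trans hρ) hΦ m)
    (summable_zpow_apply hρ hΦ hD hη.1 hK)]
  exact wnafValue_mem_add_fundamentalDomain hρ hΦ hΦΛ hD hDΛ h0 (hη.shift m) (K := K + m)
    fun j hj => hK _ (by omega)

theorem add_fundamentalDomain_eq_univ [CompleteSpace E] [DiscreteTopology Λ] (hρ : 1 < ρ)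
    (hΦ : ∀ x, ‖Φ x‖ = ρ * ‖x‖) (hΦΛ : ∀ x ∈ Λ, Φ x ∈ Λ) (hD : IsCompact D) (hDΛ : D ⊆ Λ)
    (h0 : 0 ∈ D) (hΛ : (Λ : Set E) ⊆ wnafIntegers Φ w D) (hT : Bornology.IsBounded T)
    (hΛT : (Λ : Set E) + T = univ) : (Λ : Set E) + fundamentalDomain Φ w D = univ := by
  obtain ⟨R, hR⟩ := hT.exists_norm_le
  have hclosed : IsClosed ((Λ : Set E) + fundamentalDomain Φ w D) :=
    (isClosed_coe_of_discreteTopology Λ).add_right_of_isCompact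
      (isCompact_fundamentalDomain hρ hΦ hD)
  refine eq_univ_of_forall fun x => ?_
  have happrox : ∀ k : ℕ, ∃ v ∈ (Λ : Set E) + fundamentalDomain Φ w D,
      ‖v - x‖ ≤ R * ρ⁻¹ ^ k := fun k => by
    obtain ⟨z, hz, t, ht, hzt⟩ := mem_add.1 (hΛT.symm.subset (mem_univ ((Φ ^ (k : ℤ)) x)))
    refine ⟨(Φ ^ (-k : ℤ)) z, zpow_apply_mem_add_fundamentalDomain hρ hΦ hΦΛ hD.isBounded hDΛ
      h0 (hΛ hz) _, ?_⟩
    have hx : x = (Φ ^ (-k : ℤ)) (z + t) := by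
      rw [hzt, zpow_apply_zpow_apply, neg_add_cancel, zpow_zero]
      rfl
    rw [hx, map_add, sub_add_cancel_left, norm_neg, norm_zpow_apply (one_pos.trans hρ) hΦ, zpow_neg,
      zpow_natCast, ← inv_pow, mul_comm]
    gcongr
    exact hR t ht
  choose v hv hvx using happrox
  have hlim : Tendsto (fun k : ℕ => R * ρ⁻¹ ^ k) atTop (𝓝 0) := by
    simpa using (tendsto_pow_atTop_nhds_zero_of_lt_one (by positivity)
      (inv_lt_one_of_one_lt₀ hρ)).const_mul R
  exact hclosed.mem_of_tendsto (tendsto_iff_norm_sub_tendsto_zero.2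
    (squeeze_zero (fun _ => norm_nonneg _) hvx hlim)) (.of_forall hv)

theorem norm_lt_norm_pow_apply_add (hρ : 0 < ρ) (hΦ : ∀ x, ‖Φ x‖ = ρ * ‖x‖)
    (hT : TilesBy Λ T) (hr : 0 < r) (hrT : closedBall 0 r ⊆ T) (hTR : T ⊆ closedBall 0 R)
    (hrR : R / r < ρ ^ w - 1) {e y : E} (he : e ∈ T) (hy : y ∈ Λ) (hy0 : y ≠ 0) :
    ‖y‖ < ‖(Φ ^ w) (y + e)‖ := by
  have hre : r ≤ ‖y + e‖ := by
    by_contra! hlt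
    have hint : y + e ∈ interior T :=
      interior_mono hrT (ball_subset_interior_closedBall (mem_ball_zero_iff.2 hlt))
    exact (hT.2 y hy hy0 ⟨interior_subset hint, e, he, rfl⟩).2 hint
  have heR : ‖e‖ ≤ R := mem_closedBall_zero_iff.1 (hTR he)
  have hy : ‖y‖ ≤ ‖y + e‖ + ‖e‖ := by simpa using norm_sub_le (y + e) e
  have hpow : ‖(Φ ^ w) (y + e)‖ = ρ ^ w * ‖y + e‖ := by
    simpa using norm_zpow_apply hρ hΦ w (y + e)
  rw [div_lt_iff₀ hr] at hrR
  have hpos : 0 < ρ ^ w - 1 :=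
    pos_of_mul_pos_left (((norm_nonneg e).trans heR).trans_lt hrR) hr.le
  calc ‖y‖ ≤ ‖y + e‖ + R := hy.trans (by gcongr)
    _ < ‖y + e‖ + (ρ ^ w - 1) * r := by gcongr
    _ ≤ ‖y + e‖ + (ρ ^ w - 1) * ‖y + e‖ := by gcongr
    _ = ‖(Φ ^ w) (y + e)‖ := by rw [hpow]; ring

theorem exists_eq_add_pow_apply (hρ : 1 < ρ) (hΦ : ∀ x, ‖Φ x‖ = ρ * ‖x‖) (hT : TilesBy Λ T)
    (hr : 0 < r) (hrT : closedBall 0 r ⊆ T) (hTR : T ⊆ closedBall 0 R) (hw : 1 ≤ w)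
    (hrR : R / r < ρ ^ w - 1) (hD : IsReducedResidueDigitSet Λ Φ w D) (hDT : D ⊆ (Φ ^ w) '' T)
    {z : E} (hz : z ∈ Λ) :
    ∃ d ∈ D, ∃ m, 0 < m ∧ digitLength w d ≤ m ∧ ∃ y ∈ Λ, d + (Φ ^ m) y = z ∧
      (y ≠ 0 → ‖y‖ < ‖z‖) := by
  by_cases hzΦ : z ∈ Φ '' Λ
  · obtain ⟨y, hy, rfl⟩ := hzΦ
    refine ⟨0, hD.zero_mem, 1, one_pos, digitLength_zero.le, y, hy, by simp, fun hy0 => ?_⟩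
    rw [hΦ]
    exact lt_mul_of_one_lt_left (norm_pos_iff.2 hy0) hρ
  · obtain ⟨d, ⟨hd, y, hy, hyd⟩, -⟩ := hD.existsUnique z hz hzΦ
    obtain ⟨e, he, hed⟩ := hDT hd
    have hyz : d + (Φ ^ w) y = z := by rw [hyd, add_sub_cancel]
    refine ⟨d, hd, w, hw, digitLength_le hw d, y, hy, hyz, fun hy0 => ?_⟩
    rw [← hyz, ← hed, ← map_add, add_comm e]
    exact norm_lt_norm_pow_apply_add (one_pos.trans hρ) hΦ hT hr hrT hTR hrR he hy hy0

theorem coe_subset_wnafIntegers [ProperSpace E] [DiscreteTopology Λ] (hρ : 1 < ρ)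
    (hΦ : ∀ x, ‖Φ x‖ = ρ * ‖x‖) (hT : TilesBy Λ T) (hr : 0 < r) (hrT : closedBall 0 r ⊆ T)
    (hTR : T ⊆ closedBall 0 R) (hw : 1 ≤ w) (hrR : R / r < ρ ^ w - 1)
    (hD : IsReducedResidueDigitSet Λ Φ w D) (hDb : Bornology.IsBounded D)
    (hDT : D ⊆ (Φ ^ w) '' T) : (Λ : Set E) ⊆ wnafIntegers Φ w D := by
  refine coe_subset_of_forall_norm_lt_imp_mem fun z hz ih => ?_
  obtain ⟨d, hd, m, hm0, hm, y, hy, rfl, hyz⟩ :=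
    exists_eq_add_pow_apply hρ hΦ hT hr hrT hTR hw hrR hD hDT hz
  refine add_pow_apply_mem_wnafIntegers hρ hΦ hDb hd hm0 hm ?_
  rcases eq_or_ne y 0 with rfl | hy0
  · exact zero_mem_wnafIntegers hD.zero_mem
  · exact ih y hy (hyz hy0)

end Lattice

section Dimension

theorem sum_inv_pow_digitLength {E : Type*} [Zero E] {D : Set E} [Fintype D] (h0 : 0 ∈ D) {w : ℕ}
    (hw : 1 ≤ w) {q : ℝ} (hq : 0 < q) (hcard : (D.ncard : ℝ) = q ^ (w - 1) * (q - 1) + 1) :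
    ∑ d : D, q⁻¹ ^ digitLength w d.1 = 1 := by
  classical
  have hq0 : q ≠ 0 := hq.ne'
  have h0D : 0 ∈ D.toFinset := mem_toFinset.2 h0
  have hlength : ∀ d ∈ D.toFinset.erase 0, q⁻¹ ^ digitLength w d = q⁻¹ ^ w := fun d hd => by
    rw [digitLength_of_ne_zero (Finset.ne_of_mem_erase hd)]
  have hcard' : ((D.toFinset.erase 0).card : ℝ) = q ^ (w - 1) * (q - 1) := by
    rw [← add_left_inj 1, ← hcard, ncard_eq_toFinset_card']
    exact_mod_cast Finset.card_erase_add_one h0D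
  rw [Finset.sum_set_coe (f := fun d => q⁻¹ ^ digitLength w d), ← Finset.add_sum_erase _ _ h0D,
    Finset.sum_congr rfl hlength, Finset.sum_const, nsmul_eq_mul, hcard', digitLength_zero]
  obtain ⟨v, rfl⟩ := Nat.exists_eq_add_of_le' hw
  rw [Nat.add_sub_cancel, pow_one, inv_pow, pow_succ]
  field_simp
  ring

variable {E : Type*} [NormedAddCommGroup E] [NormedSpace ℝ E] {w : ℕ} {D T : Set E}
  {Φ : E ≃ₗ[ℝ] E} {ρ r R : ℝ} {Λ : Submodule ℤ E}

theorem interior_fundamentalDomain_nonempty [ProperSpace E] [DiscreteTopology Λ] (hρ : 1 < ρ)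
    (hΦ : ∀ x, ‖Φ x‖ = ρ * ‖x‖) (hΦΛ : ∀ x ∈ Λ, Φ x ∈ Λ) (hT : TilesBy Λ T) (hr : 0 < r)
    (hrT : closedBall 0 r ⊆ T) (hTR : T ⊆ closedBall 0 R) (hw : 1 ≤ w) (hrR : R / r < ρ ^ w - 1)
    (hD : IsReducedResidueDigitSet Λ Φ w D) (hDc : IsCompact D)
    (hDT : D ⊆ (Φ ^ w) '' T) : (interior (fundamentalDomain Φ w D)).Nonempty := by
  have : Countable Λ := countable_of_Lindelof_of_discrete
  have hΛT : (Λ : Set E) + T = univ := by rw [← iUnion_add_left_image]; exact hT.1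
  have hΛF : (Λ : Set E) + fundamentalDomain Φ w D = univ :=
    add_fundamentalDomain_eq_univ hρ hΦ hΦΛ hDc hD.subset hD.zero_mem
      (coe_subset_wnafIntegers hρ hΦ hT hr hrT hTR hw hrR hD hDc.isBounded hDT)
      (isBounded_closedBall.subset hTR) hΛT
  exact interior_nonempty_of_add_eq_univ (to_countable (Λ : Set E))
    (isCompact_fundamentalDomain hρ hΦ hDc).isClosed hΛF

theorem dimH_frontier_fundamentalDomain_lt [CompleteSpace E] (hρ : 1 < ρ)
    (hΦ : ∀ x, ‖Φ x‖ = ρ * ‖x‖) (hD : D.Finite) (h0 : 0 ∈ D) (hw : 1 ≤ w) {n : ℕ} (hn : 1 ≤ n)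
    (hint : (interior (fundamentalDomain Φ w D)).Nonempty)
    (hDcard : (D.ncard : ℝ) = ρ ^ (n * (w - 1)) * (ρ ^ n - 1) + 1) :
    dimH (frontier (fundamentalDomain Φ w D)) < n := by
  have : Fintype D := hD.fintype
  have hρ0 : 0 < ρ := one_pos.trans hρ
  have hF : IsCompact (fundamentalDomain Φ w D) := isCompact_fundamentalDomain hρ hΦ hD.isCompact
  lift ρ to ℝ≥0 using hρ0.le
  have hlip : ∀ d : D, LipschitzWith (ρ⁻¹ ^ digitLength w d.1) fun x =>
      (Φ ^ (-1 : ℤ)) d.1 + (Φ ^ (-digitLength w d.1 : ℤ)) x := fun d =>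
    LipschitzWith.of_dist_le_mul fun x y => by
      rw [dist_add_left, dist_eq_norm, ← map_sub, norm_zpow_apply hρ0 hΦ, dist_eq_norm]
      simp
  have hopen : ∀ d : D, IsOpenMap fun x =>
      (Φ ^ (-1 : ℤ)) d.1 + (Φ ^ (-digitLength w d.1 : ℤ)) x := fun d =>
    (isOpenMap_add_left _).comp (isOpenMap_zpow_apply hρ0 hΦ _)
  have hsum : ∑ d : D, (ρ⁻¹ ^ digitLength w d.1) ^ ((n : ℝ≥0) : ℝ) = 1 := by
    have hsum := sum_inv_pow_digitLength h0 hw (pow_pos hρ0 n) (by rw [hDcard, pow_mul])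
    simp only [NNReal.coe_natCast, NNReal.rpow_natCast, pow_right_comm _ _ n, inv_pow _ n]
    exact_mod_cast hsum
  exact_mod_cast dimH_frontier_lt_of_eq_iUnion_image hlip hopen
    (fun d => pow_pos (inv_pos.2 (by exact_mod_cast hρ0)) _)
    (fun d => pow_lt_one' (inv_lt_one_of_one_lt₀ (by exact_mod_cast hρ)) (digitLength_pos hw _).ne')
    hF.isClosed hF.isBounded.ediam_ne_top hint
    (fundamentalDomain_eq_iUnion hρ hΦ hD.isBounded h0 hw) (by exact_mod_cast hn) hsum.le

end Dimension

section Renorming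

variable {E : Type*} [AddCommGroup E] [Module ℝ E] {N : Seminorm ℝ E}

theorem HasInducedNorm.le_mul (hN : ∀ x, N x = 0 → x = 0) {A : E →ₗ[ℝ] E} {c : ℝ}
    (hA : HasInducedNorm N A c) (x : E) : N (A x) ≤ c * N x := by
  rcases eq_or_ne x 0 with rfl | hx
  · simp
  have hpos : 0 < N x := (apply_nonneg N x).lt_of_ne' (mt (hN x) hx)
  have hunit : N (A ((N x)⁻¹ • x)) ≤ c :=
    hA.1 ⟨(N x)⁻¹ • x, by simp [map_smul_eq_mul, abs_of_pos hpos, hpos.ne'], rfl⟩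
  rwa [map_smul, map_smul_eq_mul, norm_inv, Real.norm_of_nonneg hpos.le, inv_mul_eq_div,
    div_le_iff₀ hpos] at hunit

theorem HasInducedNorm.eq_mul (hN : ∀ x, N x = 0 → x = 0) {Φ : E ≃ₗ[ℝ] E} {ρ : ℝ} (hρ : 0 < ρ)
    (hΦ : HasInducedNorm N Φ ρ) (hΦsymm : HasInducedNorm N Φ.symm ρ⁻¹) (x : E) :
    N (Φ x) = ρ * N x := by
  refine le_antisymm (HasInducedNorm.le_mul hN (A := Φ.toLinearMap) hΦ x) ?_
  simpa [inv_mul_eq_div, le_div_iff₀ hρ, mul_comm] using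
    HasInducedNorm.le_mul hN (A := Φ.symm.toLinearMap) hΦsymm (Φ x)

/-- The space `E` with the definite seminorm `N` as its norm. The topology is that of `E`, with
which the norm is compatible when `E` is finite-dimensional. -/
def Renormed (_ : ∀ x, N x = 0 → x = 0) : Type _ := E

namespace Renormed

variable {hN : ∀ x, N x = 0 → x = 0}

instance : AddCommGroup (Renormed hN) := inferInstanceAs (AddCommGroup E)

instance : Module ℝ (Renormed hN) := inferInstanceAs (Module ℝ E)

instance [FiniteDimensional ℝ E] : FiniteDimensional ℝ (Renormed hN) :=
  inferInstanceAs (FiniteDimensional ℝ E)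

instance : Norm (Renormed hN) := ⟨fun x => N x⟩

theorem core : NormedSpace.Core ℝ (Renormed hN) where
  norm_nonneg x := apply_nonneg N (x : E)
  norm_smul c x := map_smul_eq_mul N c (x : E)
  norm_triangle x y := map_add_le_add N (x : E) y
  norm_eq_zero_iff x := ⟨hN x, fun h => h ▸ map_zero N⟩

variable [t : TopologicalSpace E] [IsTopologicalAddGroup E] [ContinuousSMul ℝ E] [T2Space E]
  [FiniteDimensional ℝ E]

theorem topology_eq : t = (PseudoEMetricSpace.ofSeminormedSpaceCore
    (core (hN := hN)).toCore).toUniformSpace.toTopologicalSpace := by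
  have : IsModuleTopology ℝ E := isModuleTopologyOfFiniteDimensional
  let := NormedAddCommGroup.ofCore (core (hN := hN))
  let := NormedSpace.ofCore (core (hN := hN))
  have : IsModuleTopology ℝ (Renormed hN) := isModuleTopologyOfFiniteDimensional
  exact (eq_moduleTopology ℝ E).trans (eq_moduleTopology ℝ (Renormed hN)).symm

noncomputable instance : NormedAddCommGroup (Renormed hN) :=
  .ofCoreReplaceTopology (T := t) core topology_eq

noncomputable instance : NormedSpace ℝ (Renormed hN) :=
  .ofCore core

end Renormed

theorem dimH_renormed {E : Type*} [NormedAddCommGroup E] [NormedSpace ℝ E] [FiniteDimensional ℝ E]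
    {N : Seminorm ℝ E} (hN : ∀ x, N x = 0 → x = 0) (s : Set E) :
    dimH (X := Renormed hN) s = dimH s := by
  let e : E ≃L[ℝ] Renormed hN := (LinearEquiv.refl ℝ E).toContinuousLinearEquiv
  have := e.dimH_image s
  rwa [show e '' s = s from image_id s] at this

end Renorming

theorem finite_of_ncard_eq_pow_mul_add_one {E : Type*} {D : Set E} {ρ : ℝ} (hρ : 1 < ρ)
    {n k : ℕ} (hn : 1 ≤ n) (hDcard : (D.ncard : ℝ) = ρ ^ k * (ρ ^ n - 1) + 1) : D.Finite := by
  have hpow : 0 < ρ ^ n - 1 := sub_pos.2 (one_lt_pow₀ hρ (by omega))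
  have hpos : (0 : ℝ) < D.ncard := by rw [hDcard]; positivity
  exact finite_of_ncard_pos (by exact_mod_cast hpos)

theorem mainTheorem3_general {E : Type*} [NormedAddCommGroup E] [NormedSpace ℝ E]
    [FiniteDimensional ℝ E] {Λ : Submodule ℤ E} [DiscreteTopology Λ] {Φ : E ≃ₗ[ℝ] E}
    (hΦΛ : ∀ x ∈ Λ, Φ x ∈ Λ) {ρ : ℝ} (hρ : 1 < ρ) {T : Set E} (hT : TilesBy Λ T)
    {N : Seminorm ℝ E} (hN : ∀ x, N x = 0 → x = 0)
    (hNΦ : HasInducedNorm N Φ ρ) (hNΦinv : HasInducedNorm N Φ.symm ρ⁻¹) {r R : ℝ} (hr : 0 < r)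
    (hrT : {x | N x ≤ r} ⊆ T) (hTR : T ⊆ {x | N x ≤ R}) {w : ℕ} (hw : 1 ≤ w)
    (hrR : R / r < ρ ^ w - 1) {D : Set E} (hD : IsReducedResidueDigitSet Λ Φ w D)
    (hDT : D ⊆ (Φ ^ w : E ≃ₗ[ℝ] E) '' T) {n : ℕ} (hn : 1 ≤ n)
    (hDcard : (D.ncard : ℝ) = ρ ^ (n * (w - 1)) * (ρ ^ n - 1) + 1) :
    dimH (frontier (fundamentalDomain Φ w D)) < n := by
  have hDfin : D.Finite := finite_of_ncard_eq_pow_mul_add_one hρ hn hDcard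
  have : ProperSpace (Renormed hN) := FiniteDimensional.proper_real _
  let Λ' : Submodule ℤ (Renormed hN) := Λ
  have : DiscreteTopology Λ' := ‹DiscreteTopology Λ›
  let Φ' : Renormed hN ≃ₗ[ℝ] Renormed hN := Φ
  let D' : Set (Renormed hN) := D
  have hΦ : ∀ x, ‖Φ' x‖ = ρ * ‖x‖ := HasInducedNorm.eq_mul hN (one_pos.trans hρ) hNΦ hNΦinv
  have hball (t : ℝ) : (closedBall 0 t : Set (Renormed hN)) = {x : E | N x ≤ t} :=
    ext fun _ => mem_closedBall_zero_iff
  have hint : (interior (fundamentalDomain Φ' w D')).Nonempty :=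
    interior_fundamentalDomain_nonempty (Λ := Λ') hρ hΦ hΦΛ hT hr ((hball r).trans_subset hrT)
      (hTR.trans_eq (hball R).symm) hw hrR hD hDfin.isCompact hDT
  rw [← dimH_renormed hN]
  exact dimH_frontier_fundamentalDomain_lt hρ hΦ hDfin hD.zero_mem hw hn hint hDcard

theorem mainTheorem3 (n : ℕ) (hn : 1 ≤ n)
    (Λ : Submodule ℤ (EuclideanSpace ℝ (Fin n))) [DiscreteTopology Λ] [IsZLattice ℝ Λ]
    (Φ : EuclideanSpace ℝ (Fin n) ≃ₗ[ℝ] EuclideanSpace ℝ (Fin n))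
    (hΦΛ : ∀ x ∈ Λ, Φ x ∈ Λ)
    (ρ : ℝ) (hρ : 1 < ρ)
    (heig : ∀ μ : ℂ, Polynomial.aeval μ (LinearMap.charpoly Φ.toLinearMap) = 0 → ‖μ‖ = ρ)
    (hρn : ∃ m : ℕ, ρ ^ n = m)
    (T : Set (EuclideanSpace ℝ (Fin n))) (hT : TilesBy Λ T) (hTclosed : IsClosed T)
    (hTfrontier : MeasureTheory.volume (frontier T) = 0)
    (N : Seminorm ℝ (EuclideanSpace ℝ (Fin n))) (hN : ∀ x, N x = 0 → x = 0)
    (hNΦ : HasInducedNorm N Φ ρ) (hNΦinv : HasInducedNorm N Φ.symm ρ⁻¹)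
    (r R : ℝ) (hr : 0 < r) (hR : 0 < R)
    (hrT : {x | N x ≤ r} ⊆ T) (hTR : T ⊆ {x | N x ≤ R})
    (w : ℕ) (hw : 1 ≤ w) (hrR : R / r < ρ ^ w - 1)
    (D : Set (EuclideanSpace ℝ (Fin n))) (hD : IsReducedResidueDigitSet Λ Φ w D)
    (hDT : D ⊆ (Φ ^ w : EuclideanSpace ℝ (Fin n) ≃ₗ[ℝ] EuclideanSpace ℝ (Fin n)) '' T)
    (hDcard : (D.ncard : ℝ) = ρ ^ (n * (w - 1)) * (ρ ^ n - 1) + 1) :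
    dimH (frontier (fundamentalDomain Φ w D)) < (n : ENNReal) :=
  mainTheorem3_general hΦΛ hρ hT hN hNΦ hNΦinv hr hrT hTR hw hrR hD hDT hn hDcard
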